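/- Let $\Bbbk$ be a field of characteristic $0$ and let $A$ be an associative unital $\Bbbk$-algebra with few automorphisms. That is, the group $\mathrm{Aut}_{\rm Alg}A$ of $\Bbbk$-algebra automorphisms of $A$ satisfies: (i) there is a finite dimensional $\mathrm{Aut}_{\rm Alg}A$-invariant subspace $V\subseteq A$ such that the restriction $\mathrm{Aut}_{\rm Alg}A\to GL(V)$ is injective, and $\mathrm{Aut}_{\rm Alg}A$ is identified with its image in $GL(V)$; (ii) $\mathrm{Aut}_{\rm Alg}A$ is an algebraic (i.e. Zariski closed) subgroup of $GL(V)$; (iii) the action of $\mathrm{Aut}_{\rm Alg}A$ on $A$ is rational, i.e. $A$ is a union of finite dimensional invariant subspaces on which the matrix coefficients of the action are regular functions on $\mathrm{Aut}_{\rm Alg}A$; (iv) the Zariski connected component $(\mathrm{Aut}_{\rm Alg}A)_0$ of the identity is isomorphic, as an algebraic group, to a torus $(\Bbbk^{\times})^r$. Fix $V$ and an isomorphism $\tau:(\Bbbk^{\times})^r\to(\mathrm{Aut}_{\rm Alg}A)_0$ as above, and for $m\in\mathbb Z^r$ put $$A_{(m)}=\{a\in A:\ \tau(s)(a)=s_1^{m_1}\cdots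 s_r^{m_r}\,a\ \text{ for all } s\in(\Bbbk^{\times})^r\}.$$ Then $A=\bigoplus_{m\in\mathbb Z^r}A_{(m)}$ is an algebra grading of $A$ (the canonical grading). Moreover, for every $t\ge 0$ and every algebra grading $A=\bigoplus_{n\in\mathbb Z^t}A_n$ of $A$ there is a group homomorphism $\varphi:\mathbb Z^r\to\mathbb Z^t$ such that $$A_n=\bigoplus_{m\in\mathbb Z^r:\ \varphi(m)=n}A_{(m)}\qquad\text{for all } n\in\mathbb Z^t.$$ -/

import Mathlib

/-! Classical (rational points) language of linear algebraic groups over a field `k`, and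
associative algebras with few automorphisms. -/

section GeneralLinear

variable (k : Type*) [Field k] (V : Type*) [AddCommGroup V] [Module k V]

/-- The coordinate ring of the algebraic group `GL(V)`, `V` finite dimensional, as an algebra of
functions on `GL(V)`: it is generated by the matrix coefficients `g ↦ ξ (g v)` and by the inverse
of the determinant. -/
def glRegularFunctions : Subalgebra k ((V ≃ₗ[k] V) → k) :=
  Algebra.adjoin k
    ({F | ∃ (ξ : Module.Dual k V) (v : V), F = fun g => ξ (g v)} ∪
      {fun g : V ≃ₗ[k] V => (LinearMap.det (g : V →ₗ[k] V))⁻¹})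

/-- The Zariski topology of `GL(V)`: the non-vanishing loci of regular functions form a basis of
open sets. -/
@[reducible]
def glZariski : TopologicalSpace (V ≃ₗ[k] V) :=
  TopologicalSpace.generateFrom {U | ∃ F ∈ glRegularFunctions k V, U = {g | F g ≠ 0}}

end GeneralLinear

section Torus

variable (k : Type*) [Field k] (r : ℕ)

/-- The coordinate ring of the torus `(kˣ)^r`, as an algebra of functions on `(kˣ)^r`: the Laurent
polynomial functions. -/
def torusRegularFunctions : Subalgebra k ((Fin r → kˣ) → k) :=
  Algebra.adjoin k
    ({p | ∃ i : Fin r, p = fun t : Fin r → kˣ => (t i : k)} ∪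
      {p | ∃ i : Fin r, p = fun t : Fin r → kˣ => (t i : k)⁻¹})

variable {k r}

/-- The rational character `t ↦ t₁^{m₁} ⋯ t_r^{m_r}` of the torus `(kˣ)^r` attached to
`m ∈ ℤ^r`. -/
def torusCharacter (m : Fin r → ℤ) (t : Fin r → kˣ) : kˣ :=
  ∏ i, t i ^ m i

end Torus

section Automorphisms

variable {k : Type*} [Field k] {A : Type*} [Ring A] [Algebra k A]

/-- The subspace `V` of `A` is stable under all algebra automorphisms of `A`. -/
def AutInvariant (V : Submodule k A) : Prop :=
  ∀ (g : A ≃ₐ[k] A), ∀ v ∈ V, g v ∈ V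

/-- The restriction homomorphism `Aut(A) → GL(V)` for an `Aut(A)`-stable subspace `V`. -/
def autRestrict {V : Submodule k A} (hV : AutInvariant V) :
    (A ≃ₐ[k] A) →* (V ≃ₗ[k] V) where
  toFun g :=
    { toFun := fun v => ⟨g v, hV g v v.2⟩
      invFun := fun v => ⟨g.symm v, hV g.symm v v.2⟩
      map_add' := fun v w => Subtype.ext (by simp)
      map_smul' := fun c v => Subtype.ext (by simp)
      left_inv := fun v => Subtype.ext (by simp)
      right_inv := fun v => Subtype.ext (by simp) }
  map_one' := rfl
  map_mul' _ _ := rfl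

/-- The regular functions on `Aut(A)`, when `Aut(A)` is identified with its image in `GL(V)`: the
restrictions of the regular functions on `GL(V)`. -/
def autRegularFunctions {V : Submodule k A} (hV : AutInvariant V) : Set ((A ≃ₐ[k] A) → k) :=
  {f | ∃ F ∈ glRegularFunctions k V, f = F ∘ autRestrict hV}

/-- The Zariski topology of `Aut(A)`, when `Aut(A)` is identified with its image in `GL(V)`. -/
@[reducible]
def autZariski {V : Submodule k A} (hV : AutInvariant V) : TopologicalSpace (A ≃ₐ[k] A) :=
  TopologicalSpace.induced (autRestrict hV) (glZariski k V)

/-- The connected component of the identity of `Aut(A)`, for the Zariski topology. -/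
def autIdentityComponent {V : Submodule k A} (hV : AutInvariant V) : Set (A ≃ₐ[k] A) :=
  @connectedComponent (A ≃ₐ[k] A) (autZariski hV) 1

/-- The action of `Aut(A)` on `A` is rational: `A` is the union of finite dimensional stable
subspaces on which the matrix coefficients are regular functions on `Aut(A)`. (A linear form on a
subspace is the restriction of a linear form `ξ` on `A`.) -/
def AutActsRationally {V : Submodule k A} (hV : AutInvariant V) : Prop :=
  ∀ a : A, ∃ W : Submodule k A, a ∈ W ∧ FiniteDimensional k W ∧ AutInvariant W ∧
    ∀ w ∈ W, ∀ ξ : Module.Dual k A, (fun g : A ≃ₐ[k] A => ξ (g w)) ∈ autRegularFunctions hV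

variable (k A)

/-- An algebra with few automorphisms, together with the choices occurring in that notion: the
subspace `V` and the isomorphism of the identity component of `Aut(A)` with a torus `(kˣ)^r`. -/
structure FewAutomorphisms where
  /-- the finite dimensional `Aut(A)`-stable subspace -/
  V : Submodule k A
  finiteDimensional : FiniteDimensional k V
  invariant : AutInvariant V
  /-- `Aut(A)` is identified with a subgroup of `GL(V)` -/
  restrict_injective : Function.Injective (autRestrict invariant)
  /-- this subgroup is algebraic, that is Zariski closed -/
  isClosed_range : @IsClosed (V ≃ₗ[k] V) (glZariski k V) (Set.range (autRestrict invariant))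
  rational : AutActsRationally invariant
  /-- the rank of the torus -/
  r : ℕ
  /-- the isomorphism from the torus onto the identity component -/
  torus : (Fin r → kˣ) →* (A ≃ₐ[k] A)
  torus_injective : Function.Injective torus
  range_torus : Set.range torus = autIdentityComponent invariant
  /-- `torus` is an isomorphism of varieties onto its image: it identifies the regular functions on
  the identity component (restrictions of regular functions on `Aut(A)`) with those on
  the torus -/
  torus_regular : ∀ p : (Fin r → kˣ) → k,
    p ∈ torusRegularFunctions k r ↔ ∃ f ∈ autRegularFunctions invariant, p = f ∘ torus

variable {k A}

/-- The component `A_(m)`, `m ∈ ℤ^r`, of the canonical grading of an algebra with few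
automorphisms: the isotypic component of type `m` for the action of the identity component of
`Aut(A)`, identified with `(kˣ)^r`. -/
def FewAutomorphisms.canonical (h : FewAutomorphisms k A) (m : Fin h.r → ℤ) : Submodule k A where
  carrier := {a | ∀ t : Fin h.r → kˣ, h.torus t a = (torusCharacter m t : k) • a}
  add_mem' := fun ha hb t => by rw [map_add, ha t, hb t, smul_add]
  zero_mem' := fun t => by rw [map_zero, smul_zero]
  smul_mem' := fun c a ha t => by rw [map_smul, ha t, smul_comm]

/-- The subspace `W` is the (internal) direct sum of the family of subspaces `U`. -/
def IsDirectSumOf {ι : Type*} (W : Submodule k A) (U : ι → Submodule k A) : Prop :=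
  iSupIndep U ∧ W = ⨆ i, U i

end Automorphisms

/-! Matrix coefficients of the torus action are Laurent polynomials, i.e. combinations of
characters. Linear independence of characters then splits every vector into weight vectors and makes
the weight spaces independent; weights add under multiplication, so `canonical` is a grading.

Given a `ℤ^t`-grading, each coordinate `i` defines a one-parameter group of automorphisms: `u` acts
on degree `n` as `u ^ n i`. It depends regularly on `u`, and `kˣ`, being infinite, is connected in
the cofinite topology, so its image lies in the identity component, the torus
(`gradingAction_mem_autIdentityComponent`). Its torus coordinates are regular characters of `kˣ`,
hence powers `u ^ c i j` (`exists_gradingAction_eq_torus`). So `u` acts on weight `m` as `u ^ ∑ j, c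
i j * m j`; with `φ` given by the matrix `c`, weight `m` lies in degree `φ m`, and a refinement of
one direct sum by another is grouped by fibres (`eq_iSup_fiber_of_le`). -/

/-! ### Isotypic decomposition from linear independence of characters. -/

section Characters

variable {k G M ι : Type*} [Field k] [Monoid G] [AddCommGroup M] [Module k M]

/-- Linear forms on `M` reduce this to Dedekind's theorem for scalar coefficients. -/
theorem Finsupp.eq_zero_of_forall_sum_character_smul_eq_zero {χ : ι → G →* k}
    (hχ : Function.Injective χ) (f : ι →₀ M)
    (hf : ∀ t, (f.sum fun i x => χ i t • x) = 0) : f = 0 := by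
  ext i
  rw [Finsupp.zero_apply, ← Module.forall_dual_apply_eq_zero_iff k]
  intro ξ
  have hli := (linearIndependent_monoidHom G k).comp χ hχ
  have h0 := linearIndependent_iff.1 hli (f.mapRange ξ (map_zero ξ)) (by
    ext t
    have := congrArg ξ (hf t)
    rw [Finsupp.linearCombination_apply, Finsupp.sum_mapRange_index (by simp)]
    rw [Finsupp.sum, map_sum, map_zero] at this
    rw [Finsupp.sum, Finset.sum_apply, Pi.zero_apply, ← this]
    exact Finset.sum_congr rfl fun j _ => by simp [mul_comm])
  simpa using DFunLike.congr_fun h0 i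

theorem MonoidHom.mem_range_of_coe_mem_span {χ : ι → G →* k} {ψ : G →* k}
    (h : (ψ : G → k) ∈ Submodule.span k (Set.range fun i => (χ i : G → k))) :
    ∃ i, χ i = ψ := by
  by_contra hne
  refine (linearIndependent_monoidHom G k).notMem_span_image (s := Set.range χ) (x := ψ) hne ?_
  rwa [← Set.range_comp]

/-- The isotypic component of type `χ` of a representation. -/
def Representation.characterSpace (ρ : Representation k G M) (χ : G →* k) : Submodule k M where
  carrier := {a | ∀ t, ρ t a = χ t • a}
  add_mem' := fun ha hb t => by rw [map_add, ha t, hb t, smul_add]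
  zero_mem' := fun t => by rw [map_zero, smul_zero]
  smul_mem' := fun c a ha t => by rw [map_smul, ha t, smul_comm]

theorem Representation.iSupIndep_characterSpace (ρ : Representation k G M)
    {χ : ι → G →* k} (hχ : Function.Injective χ) :
    iSupIndep fun i => ρ.characterSpace (χ i) := by
  classical
  refine iSupIndep_of_dfinsupp_lsum_injective _ ((injective_iff_map_eq_zero _).2 fun f hf => ?_)
  have hsum : (∑ i ∈ f.support, (f i : M)) = 0 := by
    rwa [DFinsupp.lsum_apply_apply, DFinsupp.sumAddHom_apply] at hf
  let g : ι →₀ M := Finsupp.onFinset f.support (fun i => (f i : M)) fun i hi => by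
    simpa using hi
  -- Applying `ρ t` to a vanishing sum of isotypic vectors gives a relation between characters.
  have hg : g = 0 := Finsupp.eq_zero_of_forall_sum_character_smul_eq_zero hχ g fun t => by
    rw [Finsupp.onFinset_sum _ (by simp), ← map_zero (ρ t), ← hsum, map_sum]
    exact Finset.sum_congr rfl fun i _ => ((f i).2 t).symm
  ext i
  simpa [g] using DFunLike.congr_fun hg i

/-- A vector of a finite dimensional stable subspace on which the matrix coefficients are
combinations of characters is a sum of isotypic vectors. -/
theorem Representation.mem_iSup_characterSpace (ρ : Representation k G M)
    {χ : ι → G →* k} (hχ : Function.Injective χ) (W : Submodule k M) [FiniteDimensional k W]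
    (hW : ∀ t, ∀ w ∈ W, ρ t w ∈ W) {w : M} (hw : w ∈ W)
    (hreg : ∀ ξ : Module.Dual k M,
      (fun t => ξ (ρ t w)) ∈ Submodule.span k (Set.range fun i => (χ i : G → k))) :
    w ∈ ⨆ i, ρ.characterSpace (χ i) := by
  classical
  let b := Module.finBasis k W
  choose ξ hξ using fun j => LinearMap.exists_extend (b.coord j)
  choose c hc using fun j => Finsupp.mem_span_range_iff_exists_finsupp.1 (hreg (ξ j))
  -- `f i` collects the vector coefficient of `χ i` in `t ↦ ρ t w`.
  let f : ι →₀ M := ∑ j, (c j).mapRange (fun x => x • (b j : M)) (zero_smul k _)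
  have key (t : G) : ρ t w = f.sum fun i x => χ i t • x := by
    have h1 : ρ t w = ∑ j, ξ j (ρ t w) • (b j : M) := by
      have := congrArg Subtype.val (b.sum_repr ⟨ρ t w, hW t w hw⟩)
      simp only [Submodule.coe_sum, Submodule.coe_smul] at this
      refine this.symm.trans (Finset.sum_congr rfl fun j _ => ?_)
      congr 1
      have h2 := LinearMap.congr_fun (hξ j) ⟨ρ t w, hW t w hw⟩
      simp only [LinearMap.comp_apply, Submodule.subtype_apply, Module.Basis.coord_apply] at h2
      rw [h2]
    rw [h1, ← Finsupp.sum_finsetSum_index (by simp) (by simp)]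
    refine Finset.sum_congr rfl fun j _ => ?_
    rw [Finsupp.sum_mapRange_index (by simp)]
    have h3 := congrFun (hc j) t
    rw [← h3, Finsupp.sum, Finsupp.sum, Finset.sum_apply, Finset.sum_smul]
    exact Finset.sum_congr rfl fun i _ => by
      rw [Pi.smul_apply, smul_eq_mul, mul_comm, mul_smul]
  -- Compare the coefficients of `χ i t` in `ρ s (ρ t w) = ρ (s * t) w`.
  have hmem (i : ι) : f i ∈ ρ.characterSpace (χ i) := by
    intro s
    let g : ι →₀ M := Finsupp.onFinset f.support (fun i => ρ s (f i) - χ i s • f i) fun i hi => by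
      rw [Finsupp.mem_support_iff]
      rintro h0
      simp [h0] at hi
    have hg : g = 0 := Finsupp.eq_zero_of_forall_sum_character_smul_eq_zero hχ g fun t => by
      rw [Finsupp.onFinset_sum _ (by simp)]
      have h1 : ρ s (ρ t w) = ρ (s * t) w := by rw [map_mul]; rfl
      rw [key, key, Finsupp.sum, Finsupp.sum, map_sum, ← sub_eq_zero,
        ← Finset.sum_sub_distrib] at h1
      rw [← h1]
      refine Finset.sum_congr rfl fun i _ => ?_
      rw [map_smul, smul_sub, map_mul, smul_smul, mul_comm]
    simpa [g, sub_eq_zero] using DFunLike.congr_fun hg i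
  have h1 := key 1
  rw [map_one, Module.End.one_apply] at h1
  rw [h1]
  refine Submodule.sum_mem _ fun i _ => ?_
  simp only [map_one, one_smul]
  exact Submodule.mem_iSup_of_mem i (hmem i)

end Characters

/-! ### Characters and regular functions of the torus. -/

section TorusCharacters

variable (k : Type*) [Field k] {r : ℕ}

/-- `torusCharacter` as a `k`-valued monoid homomorphism. -/
def torusCharacterHom (m : Fin r → ℤ) : (Fin r → kˣ) →* k where
  toFun t := (torusCharacter m t : k)
  map_one' := by simp [torusCharacter]
  map_mul' s t := by simp [torusCharacter, mul_zpow, Finset.prod_mul_distrib]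

theorem torusCharacter_add {k : Type*} [Field k] (m n : Fin r → ℤ) (t : Fin r → kˣ) :
    torusCharacter (m + n) t = torusCharacter m t * torusCharacter n t := by
  simp [torusCharacter, zpow_add, Finset.prod_mul_distrib]

/-- Characteristic zero enters here: 2 has infinite order in `kˣ`, because `ℚ` embeds in `k`. -/
theorem zpow_injective_of_charZero [CharZero k] :
    Function.Injective fun n : ℤ => (Units.mk0 (2 : k) two_ne_zero) ^ n := by
  refine fun a b hab => ?_
  have h := congrArg Units.val hab
  simp only [Units.val_zpow_eq_zpow_val, Units.val_mk0] at h
  have h' : ((2 : ℚ) : k) ^ a = ((2 : ℚ) : k) ^ b := by simpa using h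
  rw [← Rat.cast_zpow, ← Rat.cast_zpow, Rat.cast_inj] at h'
  exact zpow_right_injective₀ (by norm_num) (by norm_num) h'

theorem torusCharacterHom_injective [CharZero k] :
    Function.Injective (torusCharacterHom k (r := r)) := by
  classical
  refine fun m n h => funext fun i => zpow_injective_of_charZero k (Units.ext ?_)
  have := DFunLike.congr_fun h (Pi.mulSingle i (Units.mk0 (2 : k) two_ne_zero))
  simp only [torusCharacterHom, torusCharacter, MonoidHom.coe_mk, OneHom.coe_mk] at this
  rw [Finset.prod_eq_single i, Finset.prod_eq_single i] at this
  · simpa using this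
  all_goals simp +contextual [Pi.mulSingle_eq_of_ne]

theorem torusRegularFunctions_le_span {p : (Fin r → kˣ) → k}
    (hp : p ∈ torusRegularFunctions k r) :
    p ∈ Submodule.span k (Set.range fun m => (torusCharacterHom k m : (Fin r → kˣ) → k)) := by
  classical
  let S : Submonoid ((Fin r → kˣ) → k) :=
    { carrier := Set.range fun m => (torusCharacterHom k m : (Fin r → kˣ) → k)
      one_mem' := ⟨0, by ext t; simp [torusCharacterHom, torusCharacter]⟩
      mul_mem' := by
        rintro _ _ ⟨m, rfl⟩ ⟨n, rfl⟩
        exact ⟨m + n, by ext t; simp [torusCharacterHom, torusCharacter_add]⟩ }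
  rw [← Subalgebra.mem_toSubmodule, torusRegularFunctions, Algebra.adjoin_eq_span] at hp
  -- The characters form a monoid, so it suffices that it contains the algebra generators.
  refine Submodule.span_mono (Submonoid.closure_le (S := S) |>.2 ?_) hp
  have key (i : Fin r) (c : ℤ) (t : Fin r → kˣ) :
      torusCharacterHom k (Pi.single i c) t = (t i : k) ^ c := by
    simp only [torusCharacterHom, torusCharacter, MonoidHom.coe_mk, OneHom.coe_mk]
    rw [Finset.prod_eq_single i]
    · simp
    all_goals simp +contextual [Pi.single_eq_of_ne]
  rintro _ (⟨i, rfl⟩ | ⟨i, rfl⟩)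
  · exact ⟨Pi.single i 1, by ext t; simp [key]⟩
  · exact ⟨Pi.single i (-1), by ext t; simp [key]⟩

end TorusCharacters

/-! ### Regular functions on the multiplicative group. -/

section LaurentFunctions

variable (k : Type*) [Field k]

open Polynomial in
/-- The Laurent polynomial functions on the multiplicative group. -/
def laurentFunctions : Subalgebra k (kˣ → k) where
  carrier := {f | ∃ (p : k[X]) (N : ℕ), ∀ u : kˣ, f u * (u : k) ^ N = p.eval (u : k)}
  mul_mem' := by
    rintro f g ⟨p, N, hp⟩ ⟨q, M, hq⟩
    refine ⟨p * q, N + M, fun u => ?_⟩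
    rw [eval_mul, ← hp, ← hq, Pi.mul_apply]
    ring
  add_mem' := by
    rintro f g ⟨p, N, hp⟩ ⟨q, M, hq⟩
    refine ⟨p * X ^ M + q * X ^ N, N + M, fun u => ?_⟩
    rw [eval_add, eval_mul, eval_mul, eval_pow, eval_pow, eval_X, ← hp, ← hq, Pi.add_apply]
    ring
  algebraMap_mem' c := ⟨C c, 0, fun u => by simp⟩

variable {k}

theorem zpow_mem_laurentFunctions (n : ℤ) : (fun u : kˣ => (u : k) ^ n) ∈ laurentFunctions k := by
  obtain ⟨m, rfl | rfl⟩ := n.eq_nat_or_neg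
  · exact ⟨Polynomial.X ^ m, 0, fun u => by simp⟩
  · exact ⟨1, m, fun u => by simp⟩

theorem finite_zeros_of_mem_laurentFunctions {f : kˣ → k} (hf : f ∈ laurentFunctions k)
    {u₀ : kˣ} (h0 : f u₀ ≠ 0) : {u | f u = 0}.Finite := by
  obtain ⟨p, N, hp⟩ := hf
  have hp0 : p ≠ 0 := by
    rintro rfl
    have := hp u₀
    simp [h0] at this
  refine Set.Finite.of_finite_image (f := fun u : kˣ => (u : k)) ?_ Units.val_injective.injOn
  refine (Polynomial.finite_setOfPred_isRoot hp0).subset ?_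
  rintro _ ⟨u, hu, rfl⟩
  simp only [Set.mem_ofPred_eq] at hu
  simp [Polynomial.IsRoot, ← hp, hu]

theorem mem_span_zpow_of_mem_laurentFunctions {f : kˣ → k} (hf : f ∈ laurentFunctions k) :
    f ∈ Submodule.span k (Set.range fun n : ℤ =>
      (((Units.coeHom k).comp (zpowGroupHom n) : kˣ →* k) : kˣ → k)) := by
  obtain ⟨p, N, hp⟩ := hf
  have : f = ∑ i ∈ Finset.range (p.natDegree + 1), p.coeff i •
      (((Units.coeHom k).comp (zpowGroupHom ((i : ℤ) - N)) : kˣ →* k) : kˣ → k) := by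
    ext u
    have h1 := hp u
    rw [Polynomial.eval_eq_sum_range, ← eq_div_iff (by simp), Finset.sum_div] at h1
    rw [h1, Finset.sum_apply]
    refine Finset.sum_congr rfl fun i _ => ?_
    simp [zpow_sub₀, mul_div_assoc]
  rw [this]
  exact Submodule.sum_mem _ fun i _ => Submodule.smul_mem _ _ (Submodule.subset_span ⟨_, rfl⟩)

/-- The regular characters of the multiplicative group are the powers. -/
theorem exists_zpow_of_mem_laurentFunctions (ψ : kˣ →* kˣ)
    (h : (fun u => (ψ u : k)) ∈ laurentFunctions k) : ∃ n : ℤ, ∀ u, ψ u = u ^ n := by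
  obtain ⟨n, hn⟩ := MonoidHom.mem_range_of_coe_mem_span
    (ψ := (Units.coeHom k).comp ψ) (mem_span_zpow_of_mem_laurentFunctions h)
  exact ⟨n, fun u => Units.ext (DFunLike.congr_fun hn u).symm⟩

/-- Needed for the generator `det⁻¹` of the coordinate ring; on powers, inversion negates the
exponent. -/
theorem laurentFunctions_comp_inv {f : kˣ → k} (hf : f ∈ laurentFunctions k) :
    (fun u => f u⁻¹) ∈ laurentFunctions k := by
  have h := mem_span_zpow_of_mem_laurentFunctions hf
  clear hf
  induction h using Submodule.span_induction with
  | mem x hx =>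
    obtain ⟨n, rfl⟩ := hx
    simpa using zpow_mem_laurentFunctions (k := k) (-n)
  | zero => exact zero_mem _
  | add f g _ _ hf hg => exact add_mem hf hg
  | smul c f _ hf => exact Subalgebra.smul_mem _ hf c

end LaurentFunctions

/-! ### One-parameter groups attached to a grading. -/

section GradingAction

variable {k : Type*} [Field k] {A : Type*} [Ring A] [Algebra k A]
  {ι : Type*} [DecidableEq ι] [AddCommMonoid ι] (𝒢 : ι → Submodule k A) [GradedAlgebra 𝒢]

/-- The linear map multiplying the component of degree `n` by `u ^ d n`. -/
def gradingLinearMap (d : ι →+ ℤ) (u : kˣ) : A →ₗ[k] A :=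
  (DirectSum.toModule k ι A fun n => ((u ^ d n : kˣ) : k) • (𝒢 n).subtype) ∘ₗ
    (DirectSum.decomposeLinearEquiv 𝒢 : A →ₗ[k] DirectSum ι fun n => 𝒢 n)

variable {𝒢} in
theorem gradingLinearMap_of_mem (d : ι →+ ℤ) (u : kˣ) {n : ι} {a : A} (ha : a ∈ 𝒢 n) :
    gradingLinearMap 𝒢 d u a = ((u ^ d n : kˣ) : k) • a := by
  lift a to 𝒢 n using ha
  simp [gradingLinearMap]

theorem gradingLinearMap_mul (d : ι →+ ℤ) (u : kˣ) (a b : A) :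
    gradingLinearMap 𝒢 d u (a * b) = gradingLinearMap 𝒢 d u a * gradingLinearMap 𝒢 d u b := by
  induction a using DirectSum.Decomposition.inductionOn 𝒢 with
  | zero => simp
  | add a a' ha ha' => simp [add_mul, ha, ha']
  | @homogeneous m a =>
    induction b using DirectSum.Decomposition.inductionOn 𝒢 with
    | zero => simp
    | add b b' hb hb' => simp [mul_add, hb, hb']
    | @homogeneous n b =>
      rw [gradingLinearMap_of_mem d u (SetLike.mul_mem_graded a.2 b.2),
        gradingLinearMap_of_mem d u a.2, gradingLinearMap_of_mem d u b.2, map_add, zpow_add,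
        Units.val_mul, smul_mul_smul_comm]

/-- The one-parameter group of algebra automorphisms attached to a grading and an integral linear
form `d` on the degrees: `u` acts on the component of degree `n` as `u ^ d n`. -/
def gradingAction (d : ι →+ ℤ) : kˣ →* (A ≃ₐ[k] A) :=
  -- A monoid homomorphism from a group has values in the units, so invertibility is automatic.
  (AlgEquiv.algHomUnitsEquiv k A).toMonoidHom.comp <| MonoidHom.toHomUnits
    { toFun := fun u => AlgHom.ofLinearMap (gradingLinearMap 𝒢 d u)
        (by rw [gradingLinearMap_of_mem d u (SetLike.one_mem_graded 𝒢)]; simp)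
        (gradingLinearMap_mul 𝒢 d u)
      map_one' := by
        ext a
        induction a using DirectSum.Decomposition.inductionOn 𝒢 with
        | zero => simp
        | add a a' ha ha' => rw [map_add, ha, ha', map_add]
        | homogeneous a => simp [gradingLinearMap_of_mem d _ a.2]
      map_mul' := fun u v => by
        ext a
        induction a using DirectSum.Decomposition.inductionOn 𝒢 with
        | zero => simp
        | add a a' ha ha' => rw [map_add, ha, ha', map_add]
        | homogeneous a => simp [gradingLinearMap_of_mem d _ a.2, mul_zpow, smul_smul, mul_comm] }

variable {𝒢} in
theorem gradingAction_of_mem (d : ι →+ ℤ) (u : kˣ) {n : ι} {a : A} (ha : a ∈ 𝒢 n) :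
    gradingAction 𝒢 d u a = ((u ^ d n : kˣ) : k) • a :=
  gradingLinearMap_of_mem d u ha

theorem gradingAction_coefficient_mem (d : ι →+ ℤ) (ξ : Module.Dual k A) (a : A) :
    (fun u => ξ (gradingAction 𝒢 d u a)) ∈ laurentFunctions k := by
  induction a using DirectSum.Decomposition.inductionOn 𝒢 with
  | zero =>
    simp only [map_zero]
    exact zero_mem (laurentFunctions k)
  | add a a' ha ha' =>
    simp only [map_add]
    exact add_mem ha ha'
  | @homogeneous n a =>
    have := mul_mem (zpow_mem_laurentFunctions (k := k) (d n))
      (algebraMap_mem (laurentFunctions k) (ξ a))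
    convert this using 1
    ext u
    simp [gradingAction_of_mem d u a.2]

end GradingAction

/-! ### Regularity of these groups and the identity component. -/

section RegularAction

variable {k : Type*} [Field k] {A : Type*} [Ring A] [Algebra k A]
  {ι : Type*} [DecidableEq ι] [AddCommMonoid ι] (𝒢 : ι → Submodule k A) [GradedAlgebra 𝒢]

theorem decompose_gradingAction (d : ι →+ ℤ) (u : kˣ) (a : A) (n : ι) :
    (DirectSum.decompose 𝒢 (gradingAction 𝒢 d u a) n : A) =
      ((u ^ d n : kˣ) : k) • (DirectSum.decompose 𝒢 a n : A) := by
  induction a using DirectSum.Decomposition.inductionOn 𝒢 with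
  | zero => simp
  | add a a' ha ha' => simp [DirectSum.decompose_add, ha, ha']
  | @homogeneous m a =>
    rw [gradingAction_of_mem d u a.2, DirectSum.decompose_smul]
    by_cases hmn : m = n
    · subst hmn
      rw [DirectSum.smul_apply, Submodule.coe_smul]
    · rw [DirectSum.smul_apply, Submodule.coe_smul, DirectSum.decompose_of_mem_ne 𝒢 a.2 hmn,
        smul_zero, smul_zero]

theorem gradingAction_dual_mem {V : Submodule k A} (hV : AutInvariant V) (d : ι →+ ℤ)
    (ξ : Module.Dual k V) (v : V) :
    (fun u => ξ (autRestrict hV (gradingAction 𝒢 d u) v)) ∈ laurentFunctions k := by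
  obtain ⟨η, hη⟩ := LinearMap.exists_extend ξ
  subst hη
  exact gradingAction_coefficient_mem 𝒢 d η v

theorem gradingAction_det_mem {V : Submodule k A} [FiniteDimensional k V] (hV : AutInvariant V)
    (d : ι →+ ℤ) :
    (fun u => LinearMap.det (autRestrict hV (gradingAction 𝒢 d u) : V →ₗ[k] V)) ∈
      laurentFunctions k := by
  classical
  let b := Module.finBasis k V
  have : (fun u => LinearMap.det (autRestrict hV (gradingAction 𝒢 d u) : V →ₗ[k] V)) =
      ∑ σ : Equiv.Perm (Fin (Module.finrank k V)), Equiv.Perm.sign σ • ∏ i,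
        fun u => b.coord (σ i) (autRestrict hV (gradingAction 𝒢 d u) (b i)) := by
    ext u
    rw [← LinearMap.det_toMatrix b, Matrix.det_apply, Finset.sum_apply]
    refine Finset.sum_congr rfl fun σ _ => ?_
    rw [Pi.smul_apply, Finset.prod_apply]
    simp [LinearMap.toMatrix_apply]
  rw [this]
  refine sum_mem fun σ _ => ?_
  rw [Units.smul_def]
  exact zsmul_mem (prod_mem fun i _ => gradingAction_dual_mem 𝒢 hV d _ _) _

theorem gradingAction_regular {V : Submodule k A} [FiniteDimensional k V] (hV : AutInvariant V)
    (d : ι →+ ℤ) {f : (A ≃ₐ[k] A) → k} (hf : f ∈ autRegularFunctions hV) :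
    (fun u => f (gradingAction 𝒢 d u)) ∈ laurentFunctions k := by
  obtain ⟨F, hF, rfl⟩ := hf
  simp only [Function.comp_apply]
  rw [glRegularFunctions] at hF
  induction hF using Algebra.adjoin_induction with
  | mem F hF =>
    obtain ⟨ξ, v, rfl⟩ | rfl := hF
    · exact gradingAction_dual_mem 𝒢 hV d ξ v
    -- The inverse determinant at `u` is the determinant at `u⁻¹`.
    · convert laurentFunctions_comp_inv (gradingAction_det_mem 𝒢 hV d) using 1
      ext u
      rw [map_inv, map_inv]
      exact (LinearEquiv.det_coe_symm _).symm
  | algebraMap c => exact algebraMap_mem (laurentFunctions k) c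
  | add F F' _ _ hF hF' => exact add_mem hF hF'
  | mul F F' _ _ hF hF' => exact mul_mem hF hF'

/-- With the cofinite topology on `kˣ` the orbit map is continuous: a Laurent function that is not
identically zero has finitely many zeros. Its image is thus connected, and it contains 1. -/
theorem gradingAction_mem_autIdentityComponent [CharZero k] {V : Submodule k A}
    [FiniteDimensional k V] (hV : AutInvariant V) (d : ι →+ ℤ) (u : kˣ) :
    gradingAction 𝒢 d u ∈ autIdentityComponent hV := by
  have : Infinite kˣ := Infinite.of_injective _ (zpow_injective_of_charZero k)
  have : Infinite (CofiniteTopology kˣ) := CofiniteTopology.of.symm.infinite_iff.2 this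
  let := autZariski hV
  have hcont : Continuous fun u : CofiniteTopology kˣ =>
      gradingAction 𝒢 d (CofiniteTopology.of.symm u) := by
    rw [continuous_induced_rng, continuous_generateFrom_iff]
    rintro _ ⟨F, hF, rfl⟩
    rw [CofiniteTopology.isOpen_iff]
    rintro ⟨u₀, hu₀⟩
    have hfin := finite_zeros_of_mem_laurentFunctions
      (gradingAction_regular 𝒢 hV d ⟨F, hF, rfl⟩) (u₀ := CofiniteTopology.of.symm u₀) hu₀
    refine (hfin.image CofiniteTopology.of).subset fun u hu => ⟨CofiniteTopology.of.symm u, ?_, ?_⟩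
    · simpa using hu
    · simp
  refine (isPreconnected_range hcont).subset_connectedComponent ⟨CofiniteTopology.of 1, ?_⟩
    ⟨CofiniteTopology.of u, ?_⟩ <;> simp

end RegularAction

/-! ### The canonical grading, and gradings as cocharacters of the torus. -/

namespace FewAutomorphisms

variable {k : Type*} [Field k] {A : Type*} [Ring A] [Algebra k A] (h : FewAutomorphisms k A)

/-- The torus action on the algebra, as a linear representation. -/
def torusRepresentation : Representation k (Fin h.r → kˣ) A where
  toFun t := (h.torus t : A →ₗ[k] A)
  map_one' := by ext; simp
  map_mul' s t := by ext; simp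

theorem iSupIndep_canonical [CharZero k] : iSupIndep h.canonical :=
  h.torusRepresentation.iSupIndep_characterSpace (torusCharacterHom_injective k)

theorem iSup_canonical [CharZero k] : ⨆ m, h.canonical m = ⊤ := by
  refine eq_top_iff.2 fun a _ => ?_
  obtain ⟨W, haW, _, hW, hreg⟩ := h.rational a
  exact h.torusRepresentation.mem_iSup_characterSpace (torusCharacterHom_injective k) W
    (fun t w hw => hW (h.torus t) w hw) haW fun ξ =>
      torusRegularFunctions_le_span k ((h.torus_regular _).2 ⟨_, hreg a haW ξ, rfl⟩)

theorem isInternal_canonical [CharZero k] : DirectSum.IsInternal h.canonical :=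
  DirectSum.isInternal_submodule_of_iSupIndep_of_iSup_eq_top h.iSupIndep_canonical h.iSup_canonical

instance canonical_gradedMonoid : SetLike.GradedMonoid h.canonical where
  one_mem t := by simp [torusCharacter]
  mul_mem m n a b ha hb t := by
    rw [map_mul, ha t, hb t, torusCharacter_add, smul_mul_smul_comm, Units.val_mul]

variable {ι : Type*} [DecidableEq ι] [AddCommMonoid ι] (𝒢 : ι → Submodule k A) [GradedAlgebra 𝒢]

/-- The one-parameter group attached to a grading is a cocharacter of the torus. -/
theorem exists_gradingAction_eq_torus [CharZero k] (d : ι →+ ℤ) :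
    ∃ c : Fin h.r → ℤ, ∀ u, gradingAction 𝒢 d u = h.torus fun j => u ^ c j := by
  have := h.finiteDimensional
  have hmem (u : kˣ) : gradingAction 𝒢 d u ∈ h.torus.range := by
    rw [← SetLike.mem_coe, MonoidHom.coe_range, h.range_torus]
    exact gradingAction_mem_autIdentityComponent 𝒢 h.invariant d u
  let ψ : kˣ →* (Fin h.r → kˣ) :=
    (MonoidHom.ofInjective h.torus_injective).symm.toMonoidHom.comp
      ((gradingAction 𝒢 d).codRestrict _ hmem)
  have hψ (u : kˣ) : h.torus (ψ u) = gradingAction 𝒢 d u :=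
    MonoidHom.apply_ofInjective_symm h.torus_injective ⟨_, hmem u⟩
  have hpow (j : Fin h.r) : ∃ n : ℤ, ∀ u, ψ u j = u ^ n := by
    refine exists_zpow_of_mem_laurentFunctions ((Pi.evalMonoidHom _ j).comp ψ) ?_
    -- The `j`-th torus coordinate comes from a regular function on `Aut(A)`, which is Laurent along
    -- the one-parameter group.
    obtain ⟨f, hf, hfj⟩ := (h.torus_regular fun t => (t j : k)).1
      (Algebra.subset_adjoin (Or.inl ⟨j, rfl⟩))
    convert gradingAction_regular 𝒢 h.invariant d hf using 1
    ext u
    rw [← hψ]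
    exact congrFun hfj (ψ u)
  choose c hc using hpow
  exact ⟨c, fun u => by rw [← hψ]; congr 1; ext j; rw [hc]⟩

end FewAutomorphisms

/-! ### Comparison of the two gradings. -/

/-- A direct sum decomposition of a module refined by another one: each piece is the sum of the
smaller pieces it contains. -/
theorem eq_iSup_fiber_of_le {R M ι κ : Type*} [Ring R] [AddCommGroup M] [Module R M]
    {P : ι → Submodule R M} {Q : κ → Submodule R M} (hP : ⨆ i, P i = ⊤) (hQ : iSupIndep Q)
    (φ : ι → κ) (hle : ∀ i, P i ≤ Q (φ i)) (n : κ) :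
    Q n = ⨆ i : {i // φ i = n}, P i := by
  set B := ⨆ i : {i // φ i = n}, P i
  have hB : B ≤ Q n := iSup_le fun i => (hle i).trans_eq (congrArg Q i.2)
  have htop : B ⊔ (⨆ j, ⨆ _ : j ≠ n, Q j) = ⊤ := by
    refine eq_top_iff.2 (hP ▸ iSup_le fun i => ?_)
    by_cases hi : φ i = n
    · exact (le_iSup (fun i : {i // φ i = n} => P i) ⟨i, hi⟩).trans le_sup_left
    · exact (hle i).trans ((le_iSup₂ (f := fun j (_ : j ≠ n) => Q j) (φ i) hi).trans le_sup_right)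
  have hdis := (hQ n).eq_bot
  -- The modular law applies because `B ≤ Q n`.
  calc Q n = (B ⊔ ⨆ j, ⨆ _ : j ≠ n, Q j) ⊓ Q n := by rw [htop, top_inf_eq]
    _ = B ⊔ (⨆ j, ⨆ _ : j ≠ n, Q j) ⊓ Q n := sup_inf_assoc_of_le _ hB
    _ = B := by rw [inf_comm, hdis, sup_bot_eq]

theorem theorem2p2 {k : Type*} [Field k] [CharZero k] {A : Type*} [Ring A] [Algebra k A]
    (h : FewAutomorphisms k A) :
    Nonempty (GradedAlgebra h.canonical) ∧
    ∀ (t : ℕ) (𝒢 : (Fin t → ℤ) → Submodule k A) [GradedAlgebra 𝒢],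
      ∃ φ : (Fin h.r → ℤ) →+ (Fin t → ℤ),
        ∀ n : Fin t → ℤ,
          IsDirectSumOf (𝒢 n) (fun m : {m : Fin h.r → ℤ // φ m = n} => h.canonical m) := by
  refine ⟨⟨h.isInternal_canonical.gradedAlgebra⟩, fun t 𝒢 _ => ?_⟩
  choose c hc using fun i : Fin t =>
    h.exists_gradingAction_eq_torus 𝒢 (Pi.evalAddMonoidHom (fun _ => ℤ) i)
  -- Row `i` of the matrix is the cocharacter of the `i`-th coordinate, paired with weights.
  let φ : (Fin h.r → ℤ) →+ (Fin t → ℤ) := (Matrix.mulVecLin (Matrix.of c)).toAddMonoidHom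
  have hφ (m : Fin h.r → ℤ) (i : Fin t) : φ m i = ∑ j, c i j * m j := rfl
  have hle (m : Fin h.r → ℤ) : h.canonical m ≤ 𝒢 (φ m) := by
    classical
    intro a ha
    rw [← DirectSum.sum_support_decompose 𝒢 a]
    refine Submodule.sum_mem _ fun n hn => ?_
    suffices n = φ m by rw [← this]; exact SetLike.coe_mem _
    refine funext fun i => zpow_injective_of_charZero k (Units.ext ?_)
    -- The nonzero degree-`n` component of `a` is scaled both by `u ^ n i` and by `u ^ φ m i`; as 2
    -- has infinite order, this one `u` separates exponents.
    set u := Units.mk0 (2 : k) two_ne_zero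
    have h1 := decompose_gradingAction 𝒢 (Pi.evalAddMonoidHom (fun _ => ℤ) i) u a n
    have h2 : torusCharacter m (fun j => u ^ c i j) = u ^ φ m i := by
      simp only [torusCharacter, hφ, ← zpow_mul]
      exact (map_sum (zmultiplesHom _ (Additive.ofMul u)) _ _).symm
    rw [hc, ha, h2, DirectSum.decompose_smul] at h1
    have hne : (DirectSum.decompose 𝒢 a n : A) ≠ 0 := by
      simpa using hn
    exact (smul_left_injective k hne h1).symm
  exact ⟨φ, fun n => ⟨h.iSupIndep_canonical.comp Subtype.val_injective,
    eq_iSup_fiber_of_le h.iSup_canonical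
      (DirectSum.Decomposition.isInternal 𝒢).submodule_iSupIndep φ hle n⟩⟩
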